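/- Let $\mu_0\ge\mu_1$ be two finite Borel measures on $\mathbb C$ with compact and infinite supports. For such a measure $\mu$ let $p_n(\mu,z)=\gamma_n(\mu)z^n+\cdots$, $\gamma_n(\mu)>0$, $n=0,1,2,\dots$, be its orthonormal polynomials, i.e. $\langle p_m(\mu,\cdot),p_n(\mu,\cdot)\rangle_\mu=\delta_{m,n}$, where $\langle g,h\rangle_\mu=\int g\,\overline{h}\,d\mu$. Assume that: (a) $\mu_1\in\mathbf{Ratio}(f)$, that is, there is $R$ such that the function $f$ is analytic in $\{z\in\mathbb C:|z|>R\}$ and $\lim_{n\to\infty}p_n(\mu_1,z)/p_{n+1}(\mu_1,z)=f(z)$ for every $z\in\mathbb{C}$ with $|z|>R$; (b) $\displaystyle\liminf_{n\to\infty}\frac{\gamma_n(\mu_1)}{\gamma_{n+1}(\mu_1)}>0$; (c) $\mu_0$ is a polynomially small (PS) perturbation of $\mu_1$, that is, $\mu_0=\mu_1+\mu_2$ for a measure $\mu_2\neq0$ with $\lim_{n\to\infty}\|p_n(\mu_1,\cdot)\|_{L^2(\mu_2)}=0$. Then the upper Hessenberg matrix $M_{\mu_0}=[b_{k,j}]_{k,j\ge0}$,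 $b_{k,j}=\langle z\,p_j(\mu_0,\cdot),p_k(\mu_0,\cdot)\rangle_{\mu_0}$, is weakly asymptotically Toeplitz: for every integer $k\ge-1$ the limit $\lim_{n\to\infty}b_{n-k,n}$ exists (as a finite complex number). -/

import Mathlib

open MeasureTheory Filter Topology Polynomial

/-- A Borel measure on the complex plane is admissible if it is finite and its (closed) support is
compact and infinite. -/
structure IsAdmissible (μ : Measure ℂ) : Prop where
  finite : IsFiniteMeasure μ
  compact_support : IsCompact μ.support
  infinite_support : μ.support.Infinite

/-- The inner product `⟨p, q⟩_μ = ∫ p(z) conj(q(z)) dμ(z)` of two polynomials. -/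
noncomputable def polyInner (μ : Measure ℂ) (p q : ℂ[X]) : ℂ :=
  ∫ z, p.eval z * (starRingEnd ℂ) (q.eval z) ∂μ

/-- The norm `‖p‖_{L²(μ)}` of a polynomial. -/
noncomputable def polyNorm (μ : Measure ℂ) (p : ℂ[X]) : ℝ :=
  Real.sqrt (∫ z, ‖p.eval z‖ ^ 2 ∂μ)

/-- The monic orthogonal polynomials of `μ`, by Gram-Schmidt applied to `1, z, z², …`. -/
noncomputable def monicOrthoPoly (μ : Measure ℂ) (n : ℕ) : ℂ[X] :=
  X ^ n - ∑ k : Fin n,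
    C (polyInner μ (X ^ n) (monicOrthoPoly μ k) /
        polyInner μ (monicOrthoPoly μ k) (monicOrthoPoly μ k)) * monicOrthoPoly μ k
termination_by n
decreasing_by all_goals exact k.isLt

/-- The orthonormal polynomial `p_n(μ, ·)`: see `orthoPoly_natDegree`, `orthoPoly_coeff` and
`orthoPoly_orthonormal` for its defining properties. -/
noncomputable def orthoPoly (μ : Measure ℂ) (n : ℕ) : ℂ[X] :=
  C (((polyNorm μ (monicOrthoPoly μ n))⁻¹ : ℝ) : ℂ) * monicOrthoPoly μ n

/-- The leading coefficient `γ_n(μ)` of `p_n(μ, ·)`, as a real number. -/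
noncomputable def orthoLeadCoeff (μ : Measure ℂ) (n : ℕ) : ℝ :=
  ((orthoPoly μ n).coeff n).re

/-- `μ₀` is a polynomially small perturbation of `μ₁`: `μ₀ = μ₁ + μ₂` for a nonzero measure `μ₂`
with `‖p_n(μ₁, ·)‖_{L²(μ₂)} → 0`. -/
def IsPSPerturbation (μ₀ μ₁ : Measure ℂ) : Prop :=
  ∃ μ₂ : Measure ℂ, μ₀ = μ₁ + μ₂ ∧ μ₂ ≠ 0 ∧
    Tendsto (fun n => polyNorm μ₂ (orthoPoly μ₁ n)) atTop (𝓝 0)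

/-- The class `Ratio(f)`: in a neighbourhood `{|z| > R}` of infinity, `f` is analytic and
`p_n(μ, z) / p_{n+1}(μ, z) → f(z)`. -/
def InRatioClass (f : ℂ → ℂ) (μ : Measure ℂ) : Prop :=
  ∃ R : ℝ, AnalyticOnNhd ℂ f {z | R < ‖z‖} ∧
    ∀ z : ℂ, R < ‖z‖ →
      Tendsto (fun n => (orthoPoly μ n).eval z / (orthoPoly μ (n + 1)).eval z) atTop (𝓝 (f z))

/-- The upper Hessenberg matrix of `μ`, with entries `b_{k,j} = ⟨z p_j, p_k⟩_μ`, `k, j ≥ 0`. -/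
noncomputable def hessenbergMatrix (μ : Measure ℂ) : Matrix ℕ ℕ ℂ :=
  Matrix.of fun k j => polyInner μ (X * orthoPoly μ j) (orthoPoly μ k)

/-- An infinite matrix `b` is weakly asymptotically Toeplitz if for every integer `k ≥ -1` the
limit of `b_{n-k,n}` as `n → ∞` exists. (The row index `n - k` is nonnegative once `n ≥ k`.) -/
def WeaklyAsymptoticallyToeplitz (b : Matrix ℕ ℕ ℂ) : Prop :=
  ∀ k : ℤ, -1 ≤ k → ∃ L : ℂ, Tendsto (fun n : ℕ => b ((n : ℤ) - k).toNat n) atTop (𝓝 L)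

theorem IsAdmissible.integrable {μ : Measure ℂ} (h : IsAdmissible μ) {E : Type*}
    [NormedAddCommGroup E] {g : ℂ → E} (hg : Continuous g) : Integrable g μ := by
  have := h.finite
  have h1 : IntegrableOn g μ.support μ := hg.continuousOn.integrableOn_compact h.compact_support
  have h2 : ∀ᵐ z ∂μ, z ∈ μ.support := Measure.support_mem_ae
  rwa [IntegrableOn, Measure.restrict_eq_self_of_ae_mem h2] at h1

theorem IsAdmissible.integrable_inner {μ : Measure ℂ} (h : IsAdmissible μ) (p q : ℂ[X]) :
    Integrable (fun z => p.eval z * (starRingEnd ℂ) (q.eval z)) μ :=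
  h.integrable (p.continuous.mul (Complex.continuous_conj.comp q.continuous))

theorem polyInner_conj (μ : Measure ℂ) (p q : ℂ[X]) :
    (starRingEnd ℂ) (polyInner μ p q) = polyInner μ q p := by
  unfold polyInner
  rw [← integral_conj]
  congr 1
  ext z
  simp [mul_comm]

theorem polyInner_C_mul_left (μ : Measure ℂ) (c : ℂ) (p q : ℂ[X]) :
    polyInner μ (C c * p) q = c * polyInner μ p q := by
  unfold polyInner
  rw [← integral_const_mul]
  congr 1
  ext z
  simp [mul_assoc]

theorem polyInner_C_mul_right (μ : Measure ℂ) (c : ℂ) (p q : ℂ[X]) :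
    polyInner μ p (C c * q) = (starRingEnd ℂ) c * polyInner μ p q := by
  rw [← polyInner_conj, polyInner_C_mul_left, map_mul, polyInner_conj]

theorem polyInner_self (μ : Measure ℂ) (p : ℂ[X]) :
    polyInner μ p p = ((polyNorm μ p ^ 2 : ℝ) : ℂ) := by
  unfold polyInner polyNorm
  rw [Real.sq_sqrt (integral_nonneg fun z => by positivity), ← integral_complex_ofReal]
  congr 1
  ext z
  rw [Complex.mul_conj, Complex.normSq_eq_norm_sq]

theorem polyNorm_ne_zero {μ : Measure ℂ} (h : IsAdmissible μ) {p : ℂ[X]} (hp : p ≠ 0) :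
    polyNorm μ p ≠ 0 := by
  intro h0
  unfold polyNorm at h0
  have hc : Continuous fun z : ℂ => ‖p.eval z‖ ^ 2 := p.continuous.norm.pow 2
  rw [Real.sqrt_eq_zero (integral_nonneg fun z => by positivity),
    integral_eq_zero_iff_of_nonneg (fun z => by positivity) (h.integrable hc)] at h0
  have hcl : IsClosed {z : ℂ | p.eval z = 0} := isClosed_eq p.continuous continuous_const
  have hsub : μ.support ⊆ {z : ℂ | p.eval z = 0} := by
    refine Measure.support_subset_of_isClosed hcl ?_
    filter_upwards [h0] with z hz
    simpa using hz
  refine h.infinite_support (Set.Finite.subset (p.roots.toFinset.finite_toSet) ?_)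
  intro z hz
  simpa [hp] using hsub hz

theorem monicOrthoPoly_degree (μ : Measure ℂ) (n : ℕ) :
    (monicOrthoPoly μ n).Monic ∧ (monicOrthoPoly μ n).natDegree = n := by
  induction n using Nat.strong_induction_on with
  | _ n ih =>
    have hs : (∑ k : Fin n, C (polyInner μ (X ^ n) (monicOrthoPoly μ k) /
        polyInner μ (monicOrthoPoly μ k) (monicOrthoPoly μ k)) * monicOrthoPoly μ k).degree
        < (n : WithBot ℕ) := by
      refine (degree_sum_le _ _).trans_lt ((Finset.sup_lt_iff (WithBot.bot_lt_coe n)).2 ?_)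
      intro k _
      rw [← smul_eq_C_mul]
      refine (degree_smul_le _ _).trans_lt ?_
      refine degree_le_natDegree.trans_lt ?_
      rw [(ih k k.isLt).2]
      exact WithBot.coe_lt_coe.2 (Nat.cast_lt.2 k.isLt)
    rw [monicOrthoPoly]
    have hm := monic_X_pow_sub hs
    refine ⟨hm, ?_⟩
    refine natDegree_eq_of_degree_eq_some ?_
    rw [degree_sub_eq_left_of_degree_lt (by rwa [degree_X_pow]), degree_X_pow]

theorem monicOrthoPoly_orthogonal {μ : Measure ℂ} (h : IsAdmissible μ) (n : ℕ) :
    ∀ m < n, polyInner μ (monicOrthoPoly μ n) (monicOrthoPoly μ m) = 0 := by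
  induction n using Nat.strong_induction_on with
  | _ n ih =>
    intro m hm
    have hne : polyInner μ (monicOrthoPoly μ m) (monicOrthoPoly μ m) ≠ 0 := by
      rw [polyInner_self]
      have := polyNorm_ne_zero h (monicOrthoPoly_degree μ m).1.ne_zero
      exact_mod_cast pow_ne_zero 2 this
    have horth : ∀ k : Fin n, k ≠ ⟨m, hm⟩ →
        polyInner μ (monicOrthoPoly μ k) (monicOrthoPoly μ m) = 0 := by
      intro k hk
      have hk' : (k : ℕ) ≠ m := fun e => hk (Fin.ext e)
      rcases lt_or_gt_of_ne hk' with h1 | h1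
      · rw [← polyInner_conj, ih m hm k h1, map_zero]
      · exact ih k k.isLt m h1
    have hsum : ∀ c : Fin n → ℂ,
        polyInner μ (X ^ n - ∑ k : Fin n, C (c k) * monicOrthoPoly μ k) (monicOrthoPoly μ m) =
        polyInner μ (X ^ n) (monicOrthoPoly μ m) -
          ∑ k : Fin n, c k * polyInner μ (monicOrthoPoly μ k) (monicOrthoPoly μ m) := by
      intro c
      simp only [← polyInner_C_mul_left]
      unfold polyInner
      rw [← integral_finsetSum _ fun k _ => h.integrable_inner _ _, ← integral_sub
        (h.integrable_inner _ _) (integrable_finsetSum _ fun k _ => h.integrable_inner _ _)]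
      congr 1
      ext z
      simp [eval_finsetSum, sub_mul, Finset.sum_mul]
    rw [monicOrthoPoly.eq_1 μ n, hsum, Finset.sum_eq_single ⟨m, hm⟩]
    · field_simp
      simp
    · intro k _ hk
      rw [horth k hk, mul_zero]
    · simp

theorem orthoPoly_natDegree {μ : Measure ℂ} (h : IsAdmissible μ) (n : ℕ) :
    (orthoPoly μ n).natDegree = n := by
  have h0 := polyNorm_ne_zero h (monicOrthoPoly_degree μ n).1.ne_zero
  unfold orthoPoly
  rw [natDegree_C_mul (by exact_mod_cast inv_ne_zero h0), (monicOrthoPoly_degree μ n).2]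

/-- The leading coefficient of `p_n(μ, ·)` is the positive real number `γ_n(μ)`. -/
theorem orthoPoly_coeff {μ : Measure ℂ} (h : IsAdmissible μ) (n : ℕ) :
    0 < orthoLeadCoeff μ n ∧ (orthoPoly μ n).coeff n = (orthoLeadCoeff μ n : ℂ) := by
  have h0 := polyNorm_ne_zero h (monicOrthoPoly_degree μ n).1.ne_zero
  have h1 : 0 < polyNorm μ (monicOrthoPoly μ n) := lt_of_le_of_ne (Real.sqrt_nonneg _) h0.symm
  have h2 : (monicOrthoPoly μ n).coeff n = 1 := by
    have := (monicOrthoPoly_degree μ n).1.coeff_natDegree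
    rwa [(monicOrthoPoly_degree μ n).2] at this
  have h3 : (orthoPoly μ n).coeff n = (((polyNorm μ (monicOrthoPoly μ n))⁻¹ : ℝ) : ℂ) := by
    rw [orthoPoly, coeff_C_mul, h2, mul_one]
  have h4 : orthoLeadCoeff μ n = (polyNorm μ (monicOrthoPoly μ n))⁻¹ := by
    rw [orthoLeadCoeff, h3, Complex.ofReal_re]
  exact ⟨h4 ▸ inv_pos.2 h1, by rw [h3, h4]⟩

theorem orthoPoly_orthonormal {μ : Measure ℂ} (h : IsAdmissible μ) (m n : ℕ) :
    polyInner μ (orthoPoly μ m) (orthoPoly μ n) = if m = n then 1 else 0 := by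
  unfold orthoPoly
  rw [polyInner_C_mul_left, polyInner_C_mul_right]
  split_ifs with hmn
  · subst hmn
    have h0 := polyNorm_ne_zero h (monicOrthoPoly_degree μ m).1.ne_zero
    rw [polyInner_self, Complex.conj_ofReal]
    norm_cast
    field_simp
  · rcases lt_or_gt_of_ne hmn with h1 | h1
    · rw [← polyInner_conj, monicOrthoPoly_orthogonal h n m h1]
      simp
    · rw [monicOrthoPoly_orthogonal h m n h1]
      simp

/-! First, the diagonals of the Hessenberg matrix of `μ₁` converge. If the measure lives in `|z| ≤
ρ`, a Christoffel-type estimate gives `∑_{m<N} |p_m(z)| ≤ (4ρ/|z|) |p_N(z)|` for `|z| ≥ 4ρ`. Divide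
`z p_n = ∑ b_{m,n} p_m` by `p_{n+1-i}`: terms with `m > n+1-i` converge by induction on `i` and
ratio asymptotics, and those with `m < n+1-i` are at most `4ρ²/|z|`. Letting `|z|` grow isolates
`b_{n+1-i,n}` (`exists_tendsto_diagonal`). For `i ≥ 1` this inverts `f(z)`. The case `i = 0` needs
no inversion and gives `γ_n/γ_{n+1} → L`; the liminf condition makes `L > 0`, hence `f ≠ 0` near
infinity (`ratio_limit_ne_zero`).

Second, the perturbation moves the entries by `o(1)`: since `γ_n(μ₀) ≤ γ_n(μ₁)`, the polynomials
`p_n(μ₁)` and `p_n(μ₀)` differ in `L²(μ₀)` by at most `‖p_n(μ₁)‖_{L²(μ₂)}`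
(`polyNorm_orthoPoly_sub_le`). -/

/-! ### The semi-inner product on polynomials. -/

/-- Every continuous function is integrable. -/
def ContinuousIntegrable (ν : Measure ℂ) : Prop :=
  ∀ g : ℂ → ℂ, Continuous g → Integrable g ν

theorem IsAdmissible.continuousIntegrable {μ : Measure ℂ} (h : IsAdmissible μ) :
    ContinuousIntegrable μ := fun _ hg => h.integrable hg

theorem ContinuousIntegrable.inner {ν : Measure ℂ} (h : ContinuousIntegrable ν) (p q : ℂ[X]) :
    Integrable (fun z => p.eval z * (starRingEnd ℂ) (q.eval z)) ν :=
  h _ (p.continuous.mul (Complex.continuous_conj.comp q.continuous))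

theorem ContinuousIntegrable.norm_sq {ν : Measure ℂ} (h : ContinuousIntegrable ν) (p : ℂ[X]) :
    Integrable (fun z => ‖p.eval z‖ ^ 2) ν := by
  refine ((h.inner p p).norm).congr (Eventually.of_forall fun z => ?_)
  simp [sq]

theorem polyInner_add_left {ν : Measure ℂ} (h : ContinuousIntegrable ν) (p q r : ℂ[X]) :
    polyInner ν (p + q) r = polyInner ν p r + polyInner ν q r := by
  unfold polyInner
  rw [← integral_add (h.inner p r) (h.inner q r)]
  simp [add_mul]

theorem polyInner_sub_left {ν : Measure ℂ} (h : ContinuousIntegrable ν) (p q r : ℂ[X]) :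
    polyInner ν (p - q) r = polyInner ν p r - polyInner ν q r := by
  unfold polyInner
  rw [← integral_sub (h.inner p r) (h.inner q r)]
  simp [sub_mul]

theorem polyInner_sub_right {ν : Measure ℂ} (h : ContinuousIntegrable ν) (p q r : ℂ[X]) :
    polyInner ν p (q - r) = polyInner ν p q - polyInner ν p r := by
  rw [← polyInner_conj, polyInner_sub_left h, map_sub, polyInner_conj, polyInner_conj]

theorem polyInner_sum_left {ν : Measure ℂ} (h : ContinuousIntegrable ν) {ι : Type*}
    (s : Finset ι) (p : ι → ℂ[X]) (r : ℂ[X]) :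
    polyInner ν (∑ i ∈ s, p i) r = ∑ i ∈ s, polyInner ν (p i) r := by
  unfold polyInner
  rw [← integral_finsetSum _ fun i _ => h.inner (p i) r]
  simp [eval_finsetSum, Finset.sum_mul]

theorem polyInner_sum_right {ν : Measure ℂ} (h : ContinuousIntegrable ν) {ι : Type*}
    (s : Finset ι) (p : ι → ℂ[X]) (r : ℂ[X]) :
    polyInner ν r (∑ i ∈ s, p i) = ∑ i ∈ s, polyInner ν r (p i) := by
  rw [← polyInner_conj, polyInner_sum_left h, map_sum]
  simp only [polyInner_conj]

theorem polyNorm_nonneg (ν : Measure ℂ) (p : ℂ[X]) : 0 ≤ polyNorm ν p := Real.sqrt_nonneg _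

theorem polyNorm_sq (ν : Measure ℂ) (p : ℂ[X]) : polyNorm ν p ^ 2 = ∫ z, ‖p.eval z‖ ^ 2 ∂ν :=
  Real.sq_sqrt (integral_nonneg fun z => by positivity)

theorem norm_polyInner_le {ν : Measure ℂ} (h : ContinuousIntegrable ν) (p q : ℂ[X]) :
    ‖polyInner ν p q‖ ≤ polyNorm ν p * polyNorm ν q := by
  -- Only a pre-inner product: `ν` may have finite support, and then nonzero polynomials can have
  -- norm zero. The arguments are swapped because `inner` is conjugate-linear in the first one.
  let core : PreInnerProductSpace.Core ℂ ℂ[X] :=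
    { inner := fun a b => polyInner ν b a
      conj_inner_symm := fun a b => polyInner_conj ν a b
      re_inner_nonneg := fun a => by
        rw [polyInner_self]
        exact sq_nonneg _
      add_left := fun a b c => by
        rw [← polyInner_conj, polyInner_add_left h, map_add, polyInner_conj, polyInner_conj]
      smul_left := fun a b r => by
        rw [smul_eq_C_mul, polyInner_C_mul_right] }
  have key := @InnerProductSpace.Core.inner_mul_inner_self_le ℂ ℂ[X] _ _ _ core p q
  change ‖polyInner ν q p‖ * ‖polyInner ν p q‖ ≤
    (polyInner ν p p).re * (polyInner ν q q).re at key
  rw [← polyInner_conj ν p q, RCLike.norm_conj, polyInner_self, polyInner_self,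
    Complex.ofReal_re, Complex.ofReal_re] at key
  refine le_of_sq_le_sq ?_ (mul_nonneg (polyNorm_nonneg _ _) (polyNorm_nonneg _ _))
  nlinarith

theorem polyNorm_X_mul_le {ν : Measure ℂ} (h : ContinuousIntegrable ν) {ρ : ℝ} (hρ : 0 ≤ ρ)
    (hν : ∀ᵐ z ∂ν, ‖z‖ ≤ ρ) (p : ℂ[X]) : polyNorm ν (X * p) ≤ ρ * polyNorm ν p := by
  refine le_of_sq_le_sq ?_ (mul_nonneg hρ (polyNorm_nonneg _ _))
  rw [mul_pow, polyNorm_sq, polyNorm_sq, ← integral_const_mul]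
  refine integral_mono_ae (h.norm_sq _) ((h.norm_sq _).const_mul _) ?_
  filter_upwards [hν] with z hz
  simp only [eval_mul, eval_X, norm_mul, mul_pow]
  gcongr

theorem norm_polyInner_X_mul_le {ν : Measure ℂ} (h : ContinuousIntegrable ν) {ρ : ℝ} (hρ : 0 ≤ ρ)
    (hν : ∀ᵐ z ∂ν, ‖z‖ ≤ ρ) (p q : ℂ[X]) :
    ‖polyInner ν (X * p) q‖ ≤ ρ * polyNorm ν p * polyNorm ν q :=
  (norm_polyInner_le h _ _).trans
    (mul_le_mul_of_nonneg_right (polyNorm_X_mul_le h hρ hν p) (polyNorm_nonneg _ _))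

theorem IsAdmissible.exists_bound {μ : Measure ℂ} (h : IsAdmissible μ) :
    ∃ ρ : ℝ, 0 < ρ ∧ ∀ᵐ z ∂μ, ‖z‖ ≤ ρ := by
  obtain ⟨ρ, hρ⟩ := h.compact_support.isBounded.exists_norm_le
  refine ⟨max ρ 1, by positivity, ?_⟩
  filter_upwards [Measure.support_mem_ae (μ := μ)] with z hz
  exact (hρ z hz).trans (le_max_left _ _)

/-! ### Orthonormal expansions and Hessenberg entries. -/

theorem polyNorm_orthoPoly {μ : Measure ℂ} (h : IsAdmissible μ) (n : ℕ) :
    polyNorm μ (orthoPoly μ n) = 1 := by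
  have h1 := polyInner_self μ (orthoPoly μ n)
  rw [orthoPoly_orthonormal h, if_pos rfl] at h1
  have h2 : polyNorm μ (orthoPoly μ n) ^ 2 = 1 := by exact_mod_cast h1.symm
  exact (pow_eq_one_iff_of_nonneg (polyNorm_nonneg _ _) two_ne_zero).1 h2

/-- Subtracting the multiple of `p_N` that cancels the coefficient of `z^N` lowers the degree and,
by orthogonality, leaves the earlier Fourier coefficients unchanged. -/
theorem eq_sum_orthoPoly {μ : Measure ℂ} (h : IsAdmissible μ) (N : ℕ) :
    ∀ q : ℂ[X], q.degree < N →
      q = ∑ i ∈ Finset.range N, C (polyInner μ q (orthoPoly μ i)) * orthoPoly μ i := by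
  have hi := h.continuousIntegrable
  induction N with
  | zero =>
    intro q hq
    simpa [Polynomial.degree_eq_bot, Nat.WithBot.lt_zero_iff] using hq
  | succ N ih =>
    intro q hq
    obtain ⟨hpos, hco⟩ := orthoPoly_coeff h N
    have hne : (orthoLeadCoeff μ N : ℂ) ≠ 0 := by exact_mod_cast hpos.ne'
    set c := q.coeff N / (orthoLeadCoeff μ N : ℂ) with hc
    have hdeg : (q - C c * orthoPoly μ N).degree < N := by
      rw [degree_lt_iff_coeff_zero]
      intro m hm
      rcases hm.eq_or_lt with rfl | hm
      · rw [coeff_sub, coeff_C_mul, hco, hc, div_mul_cancel₀ _ hne, sub_self]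
      · rw [coeff_sub, coeff_C_mul, coeff_eq_zero_of_natDegree_lt (p := orthoPoly μ N)
          (by rwa [orthoPoly_natDegree h]), (degree_lt_iff_coeff_zero _ _).1 hq m hm]
        simp
    have h1 := ih _ hdeg
    have h2 : ∀ i ∈ Finset.range N, C (polyInner μ (q - C c * orthoPoly μ N) (orthoPoly μ i)) *
        orthoPoly μ i = C (polyInner μ q (orthoPoly μ i)) * orthoPoly μ i := by
      intro i hiN
      rw [polyInner_sub_left hi, polyInner_C_mul_left, orthoPoly_orthonormal h,
        if_neg (Finset.mem_range.1 hiN).ne', mul_zero, sub_zero]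
    rw [Finset.sum_congr rfl h2, sub_eq_iff_eq_add] at h1
    have h3 : polyInner μ q (orthoPoly μ N) = c := by
      rw [h1, polyInner_add_left hi, polyInner_sum_left hi, Finset.sum_eq_zero,
        polyInner_C_mul_left, orthoPoly_orthonormal h, if_pos rfl, zero_add, mul_one]
      intro i hiN
      rw [polyInner_C_mul_left, orthoPoly_orthonormal h, if_neg (Finset.mem_range.1 hiN).ne,
        mul_zero]
    rw [Finset.sum_range_succ, h3]
    exact h1

theorem degree_X_mul_orthoPoly_lt {μ : Measure ℂ} (h : IsAdmissible μ) (n : ℕ) :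
    (X * orthoPoly μ n).degree < ((n + 2 : ℕ) : WithBot ℕ) := by
  rw [degree_lt_iff_coeff_zero]
  intro m hm
  obtain ⟨m, rfl⟩ : ∃ k, m = k + 1 := ⟨m - 1, by omega⟩
  rw [coeff_X_mul]
  exact coeff_eq_zero_of_natDegree_lt (by rw [orthoPoly_natDegree h]; omega)

/-- The recurrence relation `z p_n = ∑_{m ≤ n + 1} b_{m,n} p_m`, with any number of further
(vanishing) terms. -/
theorem orthoPoly_recurrence {μ : Measure ℂ} (h : IsAdmissible μ) {n N : ℕ} (hN : n + 2 ≤ N)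
    (z : ℂ) :
    z * (orthoPoly μ n).eval z =
      ∑ m ∈ Finset.range N, hessenbergMatrix μ m n * (orthoPoly μ m).eval z := by
  have h1 := eq_sum_orthoPoly h N _ ((degree_X_mul_orthoPoly_lt h n).trans_le
    (by exact_mod_cast hN))
  have h2 := congrArg (eval z) h1
  simpa [eval_finsetSum, hessenbergMatrix] using h2

theorem polyInner_orthoPoly_of_degree_lt {μ : Measure ℂ} (h : IsAdmissible μ) {q : ℂ[X]} {n : ℕ}
    (hq : q.degree < ((n + 1 : ℕ) : WithBot ℕ)) :
    polyInner μ q (orthoPoly μ n) = q.coeff n / (orthoLeadCoeff μ n : ℂ) := by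
  obtain ⟨hpos, hco⟩ := orthoPoly_coeff h n
  have hne : (orthoLeadCoeff μ n : ℂ) ≠ 0 := by exact_mod_cast hpos.ne'
  have h1 := congrArg (fun p => coeff p n) (eq_sum_orthoPoly h (n + 1) q hq)
  simp only [Finset.sum_range_succ, coeff_add, finsetSum_coeff, coeff_C_mul, hco] at h1
  rw [Finset.sum_eq_zero, zero_add] at h1
  · rw [h1, mul_div_cancel_right₀ _ hne]
  · intro i hi
    rw [coeff_eq_zero_of_natDegree_lt (p := orthoPoly μ i)
      (by rw [orthoPoly_natDegree h]; exact Finset.mem_range.1 hi), mul_zero]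

theorem hessenbergMatrix_subdiag {μ : Measure ℂ} (h : IsAdmissible μ) (n : ℕ) :
    hessenbergMatrix μ (n + 1) n =
      ((orthoLeadCoeff μ n / orthoLeadCoeff μ (n + 1) : ℝ) : ℂ) := by
  rw [hessenbergMatrix, Matrix.of_apply,
    polyInner_orthoPoly_of_degree_lt h (degree_X_mul_orthoPoly_lt h n), coeff_X_mul,
    (orthoPoly_coeff h n).2, Complex.ofReal_div]

theorem norm_hessenbergMatrix_le {μ : Measure ℂ} (h : IsAdmissible μ) {ρ : ℝ} (hρ : 0 ≤ ρ)
    (hμ : ∀ᵐ z ∂μ, ‖z‖ ≤ ρ) (m n : ℕ) : ‖hessenbergMatrix μ m n‖ ≤ ρ := by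
  have := norm_polyInner_X_mul_le h.continuousIntegrable hρ hμ (orthoPoly μ n) (orthoPoly μ m)
  rwa [polyNorm_orthoPoly h, polyNorm_orthoPoly h, mul_one, mul_one] at this

theorem hessenbergMatrix_eq_zero {μ : Measure ℂ} (h : IsAdmissible μ) {m n : ℕ}
    (hmn : n + 1 < m) : hessenbergMatrix μ m n = 0 := by
  rw [hessenbergMatrix, Matrix.of_apply, polyInner_orthoPoly_of_degree_lt h
    ((degree_X_mul_orthoPoly_lt h n).trans_le (by exact_mod_cast (by omega : n + 2 ≤ m + 1))),
    (degree_lt_iff_coeff_zero _ _).1 (degree_X_mul_orthoPoly_lt h n) m hmn, zero_div]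

/-! ### Growth of the orthonormal polynomials away from the support. -/

/-- The Christoffel function estimate outside a disk that carries the measure. -/
theorem sum_norm_sq_orthoPoly_le {μ : Measure ℂ} (h : IsAdmissible μ) {ρ : ℝ} (hρ : 0 ≤ ρ)
    (hμ : ∀ᵐ z ∂μ, ‖z‖ ≤ ρ) (z : ℂ) (n : ℕ) :
    (‖z‖ - ρ) * ∑ j ∈ Finset.range (n + 1), ‖(orthoPoly μ j).eval z‖ ^ 2 ≤
      ρ * (‖(orthoPoly μ n).eval z‖ * ‖(orthoPoly μ (n + 1)).eval z‖) := by
  have hi := h.continuousIntegrable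
  set p : ℕ → ℂ := fun j => (orthoPoly μ j).eval z with hp
  set S : ℝ := ∑ j ∈ Finset.range (n + 1), ‖p j‖ ^ 2 with hS
  -- `K` is the reproducing kernel at `z`, with `‖K‖² = S`. Cutting the recurrence at degree `n`
  -- loses only the `b_{n+1,n}` term, so `⟨XK, K⟩` is `zS` up to a boundary term, while its modulus
  -- is at most `ρS`.
  set K : ℂ[X] := ∑ j ∈ Finset.range (n + 1), C ((starRingEnd ℂ) (p j)) * orthoPoly μ j with hK
  have hinner : ∀ q : ℂ[X], polyInner μ q K =
      ∑ i ∈ Finset.range (n + 1), p i * polyInner μ q (orthoPoly μ i) := by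
    intro q
    rw [hK, polyInner_sum_right hi]
    refine Finset.sum_congr rfl fun i _ => ?_
    rw [polyInner_C_mul_right, Complex.conj_conj]
  have hSc : (S : ℂ) = ∑ j ∈ Finset.range (n + 1), (starRingEnd ℂ) (p j) * p j := by
    rw [hS]
    push_cast
    exact Finset.sum_congr rfl fun j _ => (Complex.conj_mul' _).symm
  have hKK : polyInner μ K K = S := by
    rw [hinner, hSc]
    refine Finset.sum_congr rfl fun i hi' => ?_
    rw [hK, polyInner_sum_left hi, Finset.sum_eq_single i]
    · rw [polyInner_C_mul_left, orthoPoly_orthonormal h, if_pos rfl]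
      ring
    · intro j _ hj
      rw [polyInner_C_mul_left, orthoPoly_orthonormal h, if_neg hj, mul_zero]
    · exact fun hn => absurd hi' hn
  have hN : polyNorm μ K ^ 2 = S := by
    rw [polyInner_self] at hKK
    exact_mod_cast hKK
  have hXK : polyInner μ (X * K) K =
      z * S - hessenbergMatrix μ (n + 1) n * ((starRingEnd ℂ) (p n) * p (n + 1)) := by
    have hexp : X * K =
        ∑ j ∈ Finset.range (n + 1), C ((starRingEnd ℂ) (p j)) * (X * orthoPoly μ j) := by
      rw [hK, Finset.mul_sum]
      exact Finset.sum_congr rfl fun j _ => by ring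
    have hcol : ∀ j ∈ Finset.range (n + 1), polyInner μ (X * orthoPoly μ j) K =
        z * p j - hessenbergMatrix μ (n + 1) j * p (n + 1) := by
      intro j hj
      have hj' := Finset.mem_range.1 hj
      have hr : z * p j = ∑ m ∈ Finset.range (n + 2), hessenbergMatrix μ m j * p m :=
        orthoPoly_recurrence h (by omega) z
      rw [Finset.sum_range_succ] at hr
      rw [hinner, hr, add_sub_cancel_right]
      exact Finset.sum_congr rfl fun i _ => mul_comm _ _
    rw [hexp, polyInner_sum_left hi]
    have : ∀ j ∈ Finset.range (n + 1),
        polyInner μ (C ((starRingEnd ℂ) (p j)) * (X * orthoPoly μ j)) K =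
        z * ((starRingEnd ℂ) (p j) * p j) -
          hessenbergMatrix μ (n + 1) j * ((starRingEnd ℂ) (p j) * p (n + 1)) := by
      intro j hj
      rw [polyInner_C_mul_left, hcol j hj]
      ring
    rw [Finset.sum_congr rfl this, Finset.sum_sub_distrib, ← Finset.mul_sum, ← hSc,
      Finset.sum_range_succ (fun j => hessenbergMatrix μ (n + 1) j * _), Finset.sum_eq_zero,
      zero_add]
    intro j hj
    rw [hessenbergMatrix_eq_zero h (by simpa using hj), zero_mul]
  have hb := norm_polyInner_X_mul_le hi hρ hμ K K
  rw [mul_assoc, ← sq, hN] at hb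
  have hS0 : 0 ≤ S := Finset.sum_nonneg fun _ _ => by positivity
  have h1 : z * S = polyInner μ (X * K) K +
      hessenbergMatrix μ (n + 1) n * ((starRingEnd ℂ) (p n) * p (n + 1)) := by
    rw [hXK]
    ring
  have h2 : ‖z‖ * S ≤ ρ * S + ρ * (‖p n‖ * ‖p (n + 1)‖) := by
    calc ‖z‖ * S = ‖z * S‖ := by rw [norm_mul, Complex.norm_of_nonneg hS0]
      _ ≤ _ := by
        rw [h1]
        refine (norm_add_le _ _).trans (add_le_add hb ?_)
        rw [norm_mul, norm_mul, RCLike.norm_conj]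
        exact mul_le_mul_of_nonneg_right (norm_hessenbergMatrix_le h hρ hμ _ _) (by positivity)
  linarith

/-- A zero of `p_{n+1}` would force the Christoffel sum, positive because of `p_0`, to be
nonpositive. -/
theorem orthoPoly_eval_ne_zero {μ : Measure ℂ} (h : IsAdmissible μ) {ρ : ℝ} (hρ : 0 ≤ ρ)
    (hμ : ∀ᵐ z ∂μ, ‖z‖ ≤ ρ) {z : ℂ} (hz : ρ < ‖z‖) (n : ℕ) : (orthoPoly μ n).eval z ≠ 0 := by
  have hzero : (orthoPoly μ 0).eval z ≠ 0 := by
    obtain ⟨hpos, hco⟩ := orthoPoly_coeff h 0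
    rw [eq_C_of_natDegree_eq_zero (orthoPoly_natDegree h 0), eval_C, hco]
    exact_mod_cast hpos.ne'
  cases n with
  | zero => exact hzero
  | succ n =>
    intro h0
    have h1 := sum_norm_sq_orthoPoly_le h hρ hμ z n
    rw [h0, norm_zero, mul_zero, mul_zero] at h1
    have h2 : 0 < ∑ j ∈ Finset.range (n + 1), ‖(orthoPoly μ j).eval z‖ ^ 2 :=
      Finset.sum_pos' (fun _ _ => by positivity) ⟨0, by simp, by positivity⟩
    nlinarith

/-- Keep only the term `j = n` of the Christoffel sum and use `|z| - ρ ≥ |z|/2`. -/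
theorem norm_orthoPoly_eval_le {μ : Measure ℂ} (h : IsAdmissible μ) {ρ : ℝ} (hρ : 0 < ρ)
    (hμ : ∀ᵐ z ∂μ, ‖z‖ ≤ ρ) {z : ℂ} (hz : 4 * ρ ≤ ‖z‖) (n : ℕ) :
    ‖(orthoPoly μ n).eval z‖ ≤ 2 * ρ / ‖z‖ * ‖(orthoPoly μ (n + 1)).eval z‖ := by
  have h1 := sum_norm_sq_orthoPoly_le h hρ.le hμ z n
  have hpos : 0 < ‖(orthoPoly μ n).eval z‖ :=
    norm_pos_iff.2 (orthoPoly_eval_ne_zero h hρ.le hμ (by linarith) n)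
  have h2 : ‖(orthoPoly μ n).eval z‖ ^ 2 ≤
      ∑ j ∈ Finset.range (n + 1), ‖(orthoPoly μ j).eval z‖ ^ 2 :=
    Finset.single_le_sum (f := fun j => ‖(orthoPoly μ j).eval z‖ ^ 2)
      (fun _ _ => by positivity) (Finset.self_mem_range_succ n)
  have h3 : (‖z‖ - ρ) * ‖(orthoPoly μ n).eval z‖ ≤ ρ * ‖(orthoPoly μ (n + 1)).eval z‖ := by
    refine le_of_mul_le_mul_right ?_ hpos
    have := (mul_le_mul_of_nonneg_left h2 (by linarith : 0 ≤ ‖z‖ - ρ)).trans h1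
    linarith
  rw [div_mul_eq_mul_div, le_div_iff₀ (by linarith)]
  nlinarith

theorem sum_norm_orthoPoly_eval_le {μ : Measure ℂ} (h : IsAdmissible μ) {ρ : ℝ} (hρ : 0 < ρ)
    (hμ : ∀ᵐ z ∂μ, ‖z‖ ≤ ρ) {z : ℂ} (hz : 4 * ρ ≤ ‖z‖) (N : ℕ) :
    ∑ m ∈ Finset.range N, ‖(orthoPoly μ m).eval z‖ ≤
      4 * ρ / ‖z‖ * ‖(orthoPoly μ N).eval z‖ := by
  have hz0 : 0 < ‖z‖ := by linarith
  induction N with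
  | zero =>
    simp only [Finset.range_zero, Finset.sum_empty]
    positivity
  | succ N ih =>
    rw [Finset.sum_range_succ]
    have hy : 4 * ρ / ‖z‖ ≤ 1 := (div_le_one hz0).2 hz
    have h1 := norm_orthoPoly_eval_le h hρ hμ hz N
    have h2 : 4 * ρ / ‖z‖ * ‖(orthoPoly μ N).eval z‖ ≤ ‖(orthoPoly μ N).eval z‖ :=
      mul_le_of_le_one_left (norm_nonneg _) hy
    calc _ ≤ 2 * (2 * ρ / ‖z‖ * ‖(orthoPoly μ (N + 1)).eval z‖) := by linarith
      _ = _ := by ring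

/-! ### Ratio asymptotics and convergence of the diagonals. -/

/-- A sequence uniformly approximable by convergent sequences converges. -/
theorem exists_tendsto_of_approx {c : ℕ → ℂ}
    (hc : ∀ ε > 0, ∃ (u : ℕ → ℂ) (L : ℂ), Tendsto u atTop (𝓝 L) ∧
      ∀ᶠ n in atTop, ‖c n - u n‖ ≤ ε) : ∃ L, Tendsto c atTop (𝓝 L) := by
  refine cauchySeq_tendsto_of_complete (Metric.cauchySeq_iff'.2 fun ε hε => ?_)
  obtain ⟨u, L, hu, hcu⟩ := hc (ε / 5) (by positivity)
  obtain ⟨N, hN⟩ := eventually_atTop.1 (hcu.and (Metric.tendsto_nhds.1 hu (ε / 5) (by positivity)))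
  have hd : ∀ n ≥ N, dist (c n) L < 2 * (ε / 5) := fun n hn => by
    have h1 := (hN n hn).1
    rw [← dist_eq_norm] at h1
    linarith [dist_triangle (c n) (u n) L, (hN n hn).2]
  refine ⟨N, fun n hn => ?_⟩
  have := dist_triangle_right (c n) (c N) L
  linarith [hd n hn, hd N le_rfl]

/-- The alternative `d = 0` serves the subdiagonal, which is treated before the limit is known to be
nonzero. -/
theorem tendsto_ratio_pow {p : ℕ → ℂ} {w : ℂ} (hp : ∀ n, p n ≠ 0)
    (hw : Tendsto (fun n => p n / p (n + 1)) atTop (𝓝 w)) {d : ℕ} (hd : d = 0 ∨ w ≠ 0) :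
    Tendsto (fun n => p (n + d) / p n) atTop (𝓝 (w⁻¹ ^ d)) := by
  induction d with
  | zero => simp [div_self (hp _)]
  | succ d ih =>
    have hw0 : w ≠ 0 := by simpa using hd
    have h1 := (hw.inv₀ hw0).comp (tendsto_add_atTop_nat d)
    rw [pow_succ']
    refine (h1.mul (ih (Or.inr hw0))).congr fun n => ?_
    have e1 := hp (n + d)
    have e2 := hp n
    have e3 := hp (n + d + 1)
    simp only [Function.comp_apply, ← add_assoc]
    field_simp

/-- The inductive step for ratio asymptotics: the diagonals converge one after the other. -/
theorem exists_tendsto_diagonal {μ : Measure ℂ} (h : IsAdmissible μ) {f : ℂ → ℂ} {R ρ : ℝ}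
    (hρ : 0 < ρ) (hμ : ∀ᵐ z ∂μ, ‖z‖ ≤ ρ)
    (hf : ∀ z : ℂ, R < ‖z‖ →
      Tendsto (fun n => (orthoPoly μ n).eval z / (orthoPoly μ (n + 1)).eval z) atTop (𝓝 (f z)))
    (i : ℕ) (hi : i = 0 ∨ ∀ z : ℂ, R < ‖z‖ → f z ≠ 0) (hR : 4 * ρ ≤ R)
    (ih : ∀ j < i, ∃ L, Tendsto (fun n => hessenbergMatrix μ (n + 1 - j) n) atTop (𝓝 L)) :
    ∃ L, Tendsto (fun n => hessenbergMatrix μ (n + 1 - i) n) atTop (𝓝 L) := by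
  refine exists_tendsto_of_approx fun ε hε => ?_
  -- At `z = x` the lower-order tail is at most `4ρ²/x ≤ ε`, whatever `n`.
  obtain ⟨x, hxR, hxε⟩ : ∃ x : ℝ, R < x ∧ 4 * ρ ^ 2 / ε ≤ x :=
    ⟨max (R + 1) (4 * ρ ^ 2 / ε), lt_max_of_lt_left (by linarith), le_max_right _ _⟩
  have hx0 : 0 < x := by linarith
  set z : ℂ := (x : ℂ) with hzdef
  have hzx : ‖z‖ = x := Complex.norm_of_nonneg hx0.le
  have hzR : R < ‖z‖ := by rwa [hzx]
  have hz4 : 4 * ρ ≤ ‖z‖ := by linarith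
  have hi' : i = 0 ∨ f z ≠ 0 := hi.imp id fun g => g z hzR
  set p : ℕ → ℂ := fun n => (orthoPoly μ n).eval z with hp
  have hp0 : ∀ n, p n ≠ 0 := orthoPoly_eval_ne_zero h hρ.le hμ (by linarith)
  have hratio : ∀ j ≤ i, Tendsto (fun n => p (n + 1 - j) / p (n + 1 - i)) atTop
      (𝓝 ((f z)⁻¹ ^ (i - j))) := by
    intro j hj
    have h1 := tendsto_ratio_pow hp0 (hf z hzR) (d := i - j) (hi'.imp (by omega) id)
    have h2 : Tendsto (fun n : ℕ => n + 1 - i) atTop atTop :=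
      (tendsto_sub_atTop_nat i).comp (tendsto_add_atTop_nat 1)
    refine (h1.comp h2).congr' ?_
    filter_upwards [eventually_ge_atTop i] with n hn
    simp only [Function.comp_apply]
    rw [show n + 1 - i + (i - j) = n + 1 - j by omega]
  -- Factored through `p_{n+1}` so that `i = 0` is covered too.
  have hlead : Tendsto (fun n => p n / p (n + 1 - i)) atTop (𝓝 (f z * (f z)⁻¹ ^ i)) := by
    refine ((hf z hzR).mul (hratio 0 (Nat.zero_le _))).congr fun n => ?_
    have := hp0 (n + 1)
    change p n / p (n + 1) * (p (n + 1) / p (n + 1 - i)) = _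
    field_simp
  choose! L hL using ih
  refine ⟨fun n => z * (p n / p (n + 1 - i)) -
    ∑ j ∈ Finset.range i, hessenbergMatrix μ (n + 1 - j) n * (p (n + 1 - j) / p (n + 1 - i)),
    _, (hlead.const_mul z).sub (tendsto_finsetSum _ fun j hj =>
      (hL j (Finset.mem_range.1 hj)).mul (hratio j (Finset.mem_range.1 hj).le)), ?_⟩
  filter_upwards [eventually_ge_atTop i] with n hn
  set N := n + 1 - i with hN
  -- Tail, wanted entry, and the `i` diagonals already known: `N + 1 + i = n + 2`.
  have hrec : z * p n = ∑ m ∈ Finset.range N, hessenbergMatrix μ m n * p m +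
      hessenbergMatrix μ N n * p N +
      ∑ j ∈ Finset.range i, hessenbergMatrix μ (n + 1 - j) n * p (n + 1 - j) := by
    rw [hp, orthoPoly_recurrence h (N := N + 1 + i) (by omega), Finset.sum_range_add,
      Finset.sum_range_succ]
    congr 1
    rw [← Finset.sum_range_reflect]
    refine Finset.sum_congr rfl fun j hj => ?_
    have := Finset.mem_range.1 hj
    rw [show N + 1 + (i - 1 - j) = n + 1 - j by omega]
  have hpN := hp0 N
  have hdiff : hessenbergMatrix μ N n - (z * (p n / p N) -
      ∑ j ∈ Finset.range i, hessenbergMatrix μ (n + 1 - j) n * (p (n + 1 - j) / p N)) =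
      -(∑ m ∈ Finset.range N, hessenbergMatrix μ m n * p m) / p N := by
    rw [← mul_div_assoc, hrec]
    simp only [← mul_div_assoc]
    rw [← Finset.sum_div]
    field_simp
    ring
  rw [hdiff, norm_div, norm_neg, div_le_iff₀ (norm_pos_iff.2 hpN)]
  calc _ ≤ ∑ m ∈ Finset.range N, ρ * ‖p m‖ := by
        refine norm_sum_le_of_le _ fun m _ => ?_
        rw [norm_mul]
        exact mul_le_mul_of_nonneg_right (norm_hessenbergMatrix_le h hρ.le hμ _ _) (norm_nonneg _)
    _ ≤ ρ * (4 * ρ / ‖z‖ * ‖p N‖) := by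
        rw [← Finset.mul_sum]
        exact mul_le_mul_of_nonneg_left (sum_norm_orthoPoly_eval_le h hρ hμ hz4 N) hρ.le
    _ = 4 * ρ ^ 2 / x * ‖p N‖ := by rw [hzx]; ring
    _ ≤ ε * ‖p N‖ := by
        refine mul_le_mul_of_nonneg_right ?_ (norm_nonneg _)
        rw [div_le_iff₀ hε] at hxε
        rw [div_le_iff₀ hx0]
        linarith

/-- Under ratio asymptotics with `lim γ_n / γ_{n+1} > 0` the ratio limit does not vanish near
infinity. -/
theorem ratio_limit_ne_zero {μ : Measure ℂ} (h : IsAdmissible μ) {ρ : ℝ} (hρ : 0 < ρ)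
    (hμ : ∀ᵐ z ∂μ, ‖z‖ ≤ ρ) {z w L : ℂ} (hz : 4 * ρ ≤ ‖z‖)
    (hw : Tendsto (fun n => (orthoPoly μ n).eval z / (orthoPoly μ (n + 1)).eval z) atTop (𝓝 w))
    (hL : Tendsto (fun n => hessenbergMatrix μ (n + 1) n) atTop (𝓝 L))
    (hlt : 4 * ρ ^ 2 < ‖L‖ * ‖z‖) : w ≠ 0 := by
  have hz0 : 0 < ‖z‖ := by linarith
  -- The recurrence divided by `p_{n+1}`, in the limit; `w = 0` would contradict `hlt`.
  have hle : ‖L - z * w‖ ≤ 4 * ρ ^ 2 / ‖z‖ := by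
    refine le_of_tendsto' ((hL.sub (hw.const_mul z)).norm) fun n => ?_
    have hp := orthoPoly_eval_ne_zero h hρ.le hμ (by linarith : ρ < ‖z‖) (n + 1)
    have hrec := orthoPoly_recurrence h (le_refl (n + 2)) z
    rw [Finset.sum_range_succ] at hrec
    have hdiff : hessenbergMatrix μ (n + 1) n -
        z * ((orthoPoly μ n).eval z / (orthoPoly μ (n + 1)).eval z) =
        -(∑ m ∈ Finset.range (n + 1), hessenbergMatrix μ m n * (orthoPoly μ m).eval z) /
          (orthoPoly μ (n + 1)).eval z := by
      rw [← mul_div_assoc, hrec]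
      field_simp
      ring
    rw [hdiff, norm_div, norm_neg, div_le_iff₀ (norm_pos_iff.2 hp)]
    calc _ ≤ ∑ m ∈ Finset.range (n + 1), ρ * ‖(orthoPoly μ m).eval z‖ := by
          refine norm_sum_le_of_le _ fun m _ => ?_
          rw [norm_mul]
          exact mul_le_mul_of_nonneg_right (norm_hessenbergMatrix_le h hρ.le hμ _ _)
            (norm_nonneg _)
      _ ≤ ρ * (4 * ρ / ‖z‖ * ‖(orthoPoly μ (n + 1)).eval z‖) := by
          rw [← Finset.mul_sum]
          exact mul_le_mul_of_nonneg_left (sum_norm_orthoPoly_eval_le h hρ hμ hz _) hρ.le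
      _ = _ := by ring
  rintro rfl
  rw [mul_zero, sub_zero, le_div_iff₀ hz0] at hle
  linarith

/-- Ratio asymptotics with `liminf γ_n / γ_{n+1} > 0` imply that all diagonals converge. -/
theorem exists_tendsto_diagonal_of_ratio {μ : Measure ℂ} (h : IsAdmissible μ) {f : ℂ → ℂ}
    (hratio : InRatioClass f μ)
    (hliminf : 0 < liminf (fun n => orthoLeadCoeff μ n / orthoLeadCoeff μ (n + 1)) atTop)
    (i : ℕ) : ∃ L, Tendsto (fun n => hessenbergMatrix μ (n + 1 - i) n) atTop (𝓝 L) := by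
  obtain ⟨R, -, hf⟩ := hratio
  obtain ⟨ρ, hρ, hμ⟩ := h.exists_bound
  obtain ⟨L, hL⟩ := exists_tendsto_diagonal h hρ hμ (R := max R (4 * ρ))
    (fun z hz => hf z ((le_max_left _ _).trans_lt hz)) 0 (Or.inl rfl) (le_max_right _ _)
    (by simp)
  simp only [Nat.sub_zero] at hL
  have hre : Tendsto (fun n => orthoLeadCoeff μ n / orthoLeadCoeff μ (n + 1)) atTop
      (𝓝 L.re) := by
    refine ((Complex.continuous_re.tendsto L).comp hL).congr fun n => ?_
    rw [Function.comp_apply, hessenbergMatrix_subdiag h, Complex.ofReal_re]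
  have hL0 : 0 < ‖L‖ := by
    rw [hre.liminf_eq] at hliminf
    exact hliminf.trans_le (Complex.re_le_norm L)
  set R' := max R (max (4 * ρ) (4 * ρ ^ 2 / ‖L‖)) with hR'
  have h1 : R ≤ R' := le_max_left _ _
  have h2 : 4 * ρ ≤ R' := (le_max_left _ _).trans (le_max_right _ _)
  have h3 : 4 * ρ ^ 2 / ‖L‖ ≤ R' := (le_max_right _ _).trans (le_max_right _ _)
  have hne : ∀ z : ℂ, R' < ‖z‖ → f z ≠ 0 := fun z hz =>
    ratio_limit_ne_zero h hρ hμ (h2.trans hz.le) (hf z (h1.trans_lt hz)) hL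
      (by
        have := h3.trans_lt hz
        rw [div_lt_iff₀ hL0] at this
        linarith)
  induction i using Nat.strong_induction_on with
  | _ i ih =>
    exact exists_tendsto_diagonal h hρ hμ (fun z hz => hf z (h1.trans_lt hz)) i (Or.inr hne) h2 ih

/-! ### Adding a measure. -/

theorem polyInner_add_measure {μ ν : Measure ℂ} (hμ : ContinuousIntegrable μ)
    (hν : ContinuousIntegrable ν) (p q : ℂ[X]) :
    polyInner (μ + ν) p q = polyInner μ p q + polyInner ν p q :=
  integral_add_measure (hμ.inner p q) (hν.inner p q)

theorem polyNorm_sq_add_measure {μ ν : Measure ℂ} (hμ : ContinuousIntegrable μ)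
    (hν : ContinuousIntegrable ν) (p : ℂ[X]) :
    polyNorm (μ + ν) p ^ 2 = polyNorm μ p ^ 2 + polyNorm ν p ^ 2 := by
  simp only [polyNorm_sq]
  exact integral_add_measure (hμ.norm_sq p) (hν.norm_sq p)

theorem polyNorm_sq_sub {ν : Measure ℂ} (h : ContinuousIntegrable ν) (p q : ℂ[X]) :
    polyNorm ν (p - q) ^ 2 =
      polyNorm ν p ^ 2 + polyNorm ν q ^ 2 - 2 * (polyInner ν p q).re := by
  have h1 := congrArg Complex.re (polyInner_self ν (p - q))
  rw [polyInner_sub_left h, polyInner_sub_right h, polyInner_sub_right h, polyInner_self,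
    polyInner_self, ← polyInner_conj ν p q, Complex.ofReal_re] at h1
  rw [← h1]
  simp only [Complex.sub_re, Complex.ofReal_re, Complex.conj_re]
  ring

/-- Leading coefficients decrease when the measure increases. -/
theorem orthoLeadCoeff_antitone {μ ν : Measure ℂ} (hμν : IsAdmissible (μ + ν))
    (hμ : IsAdmissible μ) (hν : ContinuousIntegrable ν) (n : ℕ) :
    orthoLeadCoeff (μ + ν) n ≤ orthoLeadCoeff μ n := by
  set q := orthoPoly (μ + ν) n
  have hq : polyNorm μ q ≤ 1 := by
    have h1 := polyNorm_sq_add_measure hμ.continuousIntegrable hν q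
    rw [polyNorm_orthoPoly hμν] at h1
    nlinarith [sq_nonneg (polyNorm ν q), polyNorm_nonneg μ q]
  -- The inner product equals `γ_n(μ+ν)/γ_n(μ)`, and `‖q‖_μ ≤ ‖q‖_{μ+ν} = 1`.
  have h1 := norm_polyInner_le hμ.continuousIntegrable q (orthoPoly μ n)
  have hdeg : q.degree < ((n + 1 : ℕ) : WithBot ℕ) :=
    degree_le_natDegree.trans_lt (by rw [orthoPoly_natDegree hμν]; exact_mod_cast n.lt_succ_self)
  obtain ⟨hp, -⟩ := orthoPoly_coeff hμ n
  obtain ⟨hp', hco⟩ := orthoPoly_coeff hμν n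
  rw [polyNorm_orthoPoly hμ, polyInner_orthoPoly_of_degree_lt hμ hdeg, hco, norm_div,
    Complex.norm_of_nonneg hp.le, Complex.norm_of_nonneg hp'.le, mul_one] at h1
  exact (div_le_one hp).1 (h1.trans hq)

/-- The orthonormal polynomials of a perturbed measure, compared with the original ones. -/
theorem polyNorm_orthoPoly_sub_le {μ ν : Measure ℂ} (hμν : IsAdmissible (μ + ν))
    (hμ : IsAdmissible μ) (hν : ContinuousIntegrable ν) (n : ℕ) :
    polyNorm (μ + ν) (orthoPoly μ n - orthoPoly (μ + ν) n) ≤ polyNorm ν (orthoPoly μ n) := by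
  refine le_of_sq_le_sq ?_ (polyNorm_nonneg _ _)
  obtain ⟨-, hco⟩ := orthoPoly_coeff hμ n
  obtain ⟨hp', -⟩ := orthoPoly_coeff hμν n
  have hdeg : (orthoPoly μ n).degree < ((n + 1 : ℕ) : WithBot ℕ) :=
    degree_le_natDegree.trans_lt (by rw [orthoPoly_natDegree hμ]; exact_mod_cast n.lt_succ_self)
  have hge : 1 ≤ orthoLeadCoeff μ n / orthoLeadCoeff (μ + ν) n :=
    (one_le_div hp').2 (orthoLeadCoeff_antitone hμν hμ hν n)
  -- The square is `2 + ‖p_n(μ)‖_ν² - 2γ_n(μ)/γ_n(μ+ν)`, and the quotient is at least 1.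
  rw [polyNorm_sq_sub hμν.continuousIntegrable, polyNorm_orthoPoly hμν,
    polyNorm_sq_add_measure hμ.continuousIntegrable hν, polyNorm_orthoPoly hμ,
    polyInner_orthoPoly_of_degree_lt hμν hdeg, hco, ← Complex.ofReal_div, Complex.ofReal_re]
  linarith

/-- The entries of the Hessenberg matrices of a measure and its perturbation. -/
theorem norm_hessenbergMatrix_sub_le {μ ν : Measure ℂ} (hμν : IsAdmissible (μ + ν))
    (hμ : IsAdmissible μ) (hν : ContinuousIntegrable ν) {ρ : ℝ} (hρ : 0 ≤ ρ)
    (hb : ∀ᵐ z ∂(μ + ν), ‖z‖ ≤ ρ) (m n : ℕ) :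
    ‖hessenbergMatrix (μ + ν) m n - hessenbergMatrix μ m n‖ ≤
      ρ * polyNorm ν (orthoPoly μ n) +
        ρ * (1 + polyNorm ν (orthoPoly μ n)) * polyNorm ν (orthoPoly μ m) +
        ρ * polyNorm ν (orthoPoly μ n) * polyNorm ν (orthoPoly μ m) := by
  have hi := hμν.continuousIntegrable
  set P := orthoPoly μ
  set Q := orthoPoly (μ + ν)
  have hbν : ∀ᵐ z ∂ν, ‖z‖ ≤ ρ := ae_mono (Measure.le_add_left le_rfl) hb
  have hPn : polyNorm (μ + ν) (P n) ≤ 1 + polyNorm ν (P n) := by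
    refine le_of_sq_le_sq ?_ (by linarith [polyNorm_nonneg ν (P n)])
    rw [polyNorm_sq_add_measure hμ.continuousIntegrable hν, polyNorm_orthoPoly hμ]
    nlinarith [polyNorm_nonneg ν (P n)]
  have hsplit : hessenbergMatrix (μ + ν) m n - hessenbergMatrix μ m n =
      -polyInner (μ + ν) (X * (P n - Q n)) (Q m) -
        polyInner (μ + ν) (X * P n) (P m - Q m) + polyInner ν (X * P n) (P m) := by
    have h1 := polyInner_add_measure hμ.continuousIntegrable hν (X * P n) (P m)
    simp only [hessenbergMatrix, Matrix.of_apply]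
    rw [mul_sub, polyInner_sub_left hi, polyInner_sub_right hi, h1]
    ring
  rw [hsplit]
  refine (norm_add_le _ _).trans (add_le_add ((norm_sub_le _ _).trans (add_le_add ?_ ?_)) ?_)
  · rw [norm_neg]
    refine (norm_polyInner_X_mul_le hi hρ hb _ _).trans ?_
    rw [polyNorm_orthoPoly hμν, mul_one]
    exact mul_le_mul_of_nonneg_left (polyNorm_orthoPoly_sub_le hμν hμ hν n) hρ
  · refine (norm_polyInner_X_mul_le hi hρ hb _ _).trans ?_
    exact mul_le_mul (mul_le_mul_of_nonneg_left hPn hρ) (polyNorm_orthoPoly_sub_le hμν hμ hν m)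
      (polyNorm_nonneg _ _) (mul_nonneg hρ (by linarith [polyNorm_nonneg ν (P n)]))
  · exact norm_polyInner_X_mul_le hν hρ hbν _ _

theorem proposition2p5 (μ₀ μ₁ : Measure ℂ) (h₀ : IsAdmissible μ₀) (h₁ : IsAdmissible μ₁)
    (f : ℂ → ℂ) (hratio : InRatioClass f μ₁)
    (hliminf : 0 < liminf (fun n => orthoLeadCoeff μ₁ n / orthoLeadCoeff μ₁ (n + 1)) atTop)
    (hPS : IsPSPerturbation μ₀ μ₁) :
    WeaklyAsymptoticallyToeplitz (hessenbergMatrix μ₀) := by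
  intro k hk
  obtain ⟨μ₂, rfl, -, hlim⟩ := hPS
  -- `μ₂` need not be admissible: its support may be finite.
  have h₂ : ContinuousIntegrable μ₂ := fun g hg =>
    (h₀.integrable hg).mono_measure (Measure.le_add_left le_rfl)
  obtain ⟨i, hi⟩ : ∃ i : ℕ, k = (i : ℤ) - 1 := ⟨(k + 1).toNat, by omega⟩
  have hidx : ∀ n : ℕ, ((n : ℤ) - k).toNat = n + 1 - i := fun n => by omega
  simp only [hidx]
  obtain ⟨L, hL⟩ := exists_tendsto_diagonal_of_ratio h₁ hratio hliminf i
  obtain ⟨ρ, hρ, hb⟩ := h₀.exists_bound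
  have hlim' : Tendsto (fun n => polyNorm μ₂ (orthoPoly μ₁ (n + 1 - i))) atTop (𝓝 0) :=
    hlim.comp ((tendsto_sub_atTop_nat i).comp (tendsto_add_atTop_nat 1))
  have hbound := ((hlim.const_mul ρ).add (((hlim.const_add 1).const_mul ρ).mul hlim')).add
    ((hlim.const_mul ρ).mul hlim')
  simp only [mul_zero, add_zero] at hbound
  have hdiff := squeeze_zero_norm
    (fun n => norm_hessenbergMatrix_sub_le h₀ h₁ h₂ hρ.le hb (n + 1 - i) n) hbound
  exact ⟨L, by simpa using hL.add hdiff⟩
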